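/- Let $(X,d)$ be a metric space in which every ball $B(x,r)$ has compact closure, and let $\mu$ be a Radon measure on $X$ with full support that is Ahlfors $d_H$-regular for some $d_H>0$: there are $c_1,c_2>0$ with $c_1r^{d_H}\le\mu(B(x,r))\le c_2r^{d_H}$ for all $x\in X$, $r\ge 0$. Let $(\mathcal E,\mathcal F)$ be a regular, strongly local Dirichlet form on $L^2(X,\mu)$ whose heat semigroup $\{P_t\}_{t>0}$ has a continuous heat kernel $p_t(x,y)$ satisfying, for some $c_3,c_4,c_5,c_6>0$ and $d_W\in[2,\infty)$, the sub-Gaussian estimates $$c_5t^{-d_H/d_W}\exp\Big(-c_6\Big(\tfrac{d(x,y)^{d_W}}{t}\Big)^{\frac1{d_W-1}}\Big)\le p_t(x,y)\le c_3t^{-d_H/d_W}\exp\Big(-c_4\Big(\tfrac{d(x,y)^{d_W}}{t}\Big)^{\frac1{d_W-1}}\Big)$$ for each $t>0$ and $\mu\times\mu$-a.e. $(x,y)$. Fix $0<\delta<1$. For $t>0$ let $\eta_t^{(\delta)}$ be the non-negative continuous function on $(0,\infty)$ with $\int_0^\infty\eta_t^{(\delta)}(s)e^{-s\lambda}\,ds=e^{-t\lambda^\delta}$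 for all $\lambda>0$, and let $p_t^{(\delta)}(x,y)=\int_0^\infty\eta_t^{(\delta)}(s)\,p_s(x,y)\,ds$ be the heat kernel of the subordinated semigroup $P^{(\delta)}_t=\int_0^\infty \eta_t^{(\delta)}(s)P_s\,ds$ (generated by $-(-L)^\delta$, where $L$ is the generator of $P_t$). For $\alpha>0$ and measurable $f$ put $$\|f\|_{1,\alpha}=\sup_{t>0}t^{-\alpha}\int_X\int_X|f(x)-f(y)|\,p_t^{(\delta)}(x,y)\,d\mu(x)\,d\mu(y)\in[0,\infty],$$ $\mathbf B^{1,\alpha}(X)=\{f\in L^1(X,\mu):\|f\|_{1,\alpha}<\infty\}$, and $$\alpha_1^\#=\sup\{\alpha>0:\mathbf B^{1,\alpha}(X)\text{ contains non-constant functions}\},$$ where constant means $\mu$-a.e. equal to a constant. For $f:X\to\mathbb R$ write $E_t(f)=\{x\in X: f(x)>t\}$. Assume $\alpha_1^\#=1$. Then: 1. There exist constants $C_1,C_2>0$ such that for every non-negative $f\in L^1(X,\mu)$ $$C_1\int_0^\infty\|\mathbf 1_{E_t(f)}\|_{1,1}\,dt\le\|f\|_{1,1}\le C_2\int_0^\infty\|\mathbf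 1_{E_t(f)}\|_{1,1}\,dt$$ (as an inequality in $[0,\infty]$). 2. For every $f\in\mathbf B^{1,1}(X)$ one has $\mathbf 1_{E_t(f)}\in\mathbf B^{1,1}(X)$ for almost every $t>0$. 3. Conversely, if $f\in L^1(X,\mu)$ is non-negative, $\mathbf 1_{E_t(f)}\in\mathbf B^{1,1}(X)$ for almost every $t>0$, and $\int_0^\infty\|\mathbf 1_{E_t(f)}\|_{1,1}\,dt<\infty$, then $f\in\mathbf B^{1,1}(X)$. -/

import Mathlib

open MeasureTheory Set Filter Topology
open scoped ENNReal NNReal CompactlySupported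

namespace FracBesov

variable {X : Type*} [MetricSpace X] [MeasurableSpace X]

/-- `c₁ r ^ dH ≤ μ (B(x, r)) ≤ c₂ r ^ dH` for all `x` and all `r ≥ 0`. -/
def IsAhlforsRegular (μ : Measure X) (dH : ℝ) : Prop :=
  ∃ c₁ c₂ : ℝ, 0 < c₁ ∧ 0 < c₂ ∧ ∀ (x : X) (r : ℝ), 0 ≤ r →
    ENNReal.ofReal (c₁ * r ^ dH) ≤ μ (Metric.ball x r) ∧
      μ (Metric.ball x r) ≤ ENNReal.ofReal (c₂ * r ^ dH)

/-- A Dirichlet form on `L²(X, μ)`: a densely defined, closed, symmetric, nonnegative, Markovian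
bilinear form. -/
structure DirichletForm (μ : Measure X) where
  /-- the domain `ℱ` -/
  domain : Submodule ℝ (Lp ℝ 2 μ)
  /-- the form `ℰ` on `ℱ × ℱ` -/
  form : domain →ₗ[ℝ] domain →ₗ[ℝ] ℝ
  dense_domain : Dense (domain : Set (Lp ℝ 2 μ))
  symm : ∀ u v, form u v = form v u
  nonneg : ∀ u, 0 ≤ form u u
  /-- `ℱ` is complete for the norm `(‖u‖² + ℰ(u, u))^{1/2}`. -/
  closed : ∀ u : ℕ → domain,
    (∀ ε : ℝ, 0 < ε → ∃ N : ℕ, ∀ m n : ℕ, N ≤ m → N ≤ n →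
      ‖((u m - u n : domain) : Lp ℝ 2 μ)‖ ^ 2 + form (u m - u n) (u m - u n) < ε) →
    ∃ v : domain, Tendsto
      (fun n => ‖((u n - v : domain) : Lp ℝ 2 μ)‖ ^ 2 + form (u n - v) (u n - v)) atTop (𝓝 0)
  /-- The unit contraction `(0 ∨ u) ∧ 1` of `u ∈ ℱ` is in `ℱ` and does not increase the energy. -/
  markov : ∀ (u : domain) (v : Lp ℝ 2 μ),
    (∀ᵐ x ∂μ, v x = min (max ((u : Lp ℝ 2 μ) x) 0) 1) →
    ∃ hv : v ∈ domain, form ⟨v, hv⟩ ⟨v, hv⟩ ≤ form u u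

/-- The support of (the class of) a function: the complement of the largest open set on which it
vanishes almost everywhere. -/
def essSupport (μ : Measure X) (f : X → ℝ) : Set X :=
  {x | ∀ U : Set X, IsOpen U → x ∈ U → ¬ ∀ᵐ y ∂μ, y ∈ U → f y = 0}

namespace DirichletForm

variable {μ : Measure X} (E : DirichletForm μ)

/-- `C_c(X) ∩ ℱ` is dense in `C_c(X)` for the supremum norm and dense in `ℱ` for the norm
`(‖u‖² + ℰ(u, u))^{1/2}`; that is, the form has a core. -/
def IsRegular : Prop :=
  (∀ (φ : C_c(X, ℝ)) (ε : ℝ), 0 < ε →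
    ∃ ψ : C_c(X, ℝ), (∃ v : E.domain, ∀ᵐ x ∂μ, (v : Lp ℝ 2 μ) x = ψ x) ∧
      ∀ x, |φ x - ψ x| < ε) ∧
  (∀ (u : E.domain) (ε : ℝ), 0 < ε →
    ∃ v : E.domain, (∃ ψ : C_c(X, ℝ), ∀ᵐ x ∂μ, (v : Lp ℝ 2 μ) x = ψ x) ∧
      ‖((u - v : E.domain) : Lp ℝ 2 μ)‖ ^ 2 + E.form (u - v) (u - v) < ε)

/-- `ℰ(f, g) = 0` whenever `f, g ∈ ℱ` have compact supports and `f` is constant in a neighbourhood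
of the support of `g`. -/
def IsStronglyLocal : Prop :=
  ∀ f g : E.domain,
    IsCompact (essSupport μ (f : Lp ℝ 2 μ)) → IsCompact (essSupport μ (g : Lp ℝ 2 μ)) →
    (∃ (U : Set X) (c : ℝ), IsOpen U ∧ essSupport μ (g : Lp ℝ 2 μ) ⊆ U ∧
      ∀ᵐ x ∂μ, x ∈ U → (f : Lp ℝ 2 μ) x = c) →
    E.form f g = 0

/-- `(P t)_{t > 0}` is the heat semigroup of the form: the strongly continuous semigroup of
symmetric contractions on `L²(X, μ)` for which `ℱ` is the set of `f` such that
`t⁻¹ ⟨f - P t f, f⟩` has a finite limit as `t → 0⁺`, and `ℰ(f, f)` is that limit. -/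
structure IsHeatSemigroup (P : ℝ → Lp ℝ 2 μ →L[ℝ] Lp ℝ 2 μ) : Prop where
  semigroup : ∀ s t : ℝ, 0 < s → 0 < t → P (s + t) = (P s).comp (P t)
  contraction : ∀ t : ℝ, 0 < t → ‖P t‖ ≤ 1
  symm : ∀ t : ℝ, 0 < t → ∀ f g : Lp ℝ 2 μ, inner ℝ (P t f) g = inner ℝ f (P t g)
  tendsto_id : ∀ f : Lp ℝ 2 μ, Tendsto (fun t => P t f) (𝓝[>] 0) (𝓝 f)
  form_iff : ∀ (f : Lp ℝ 2 μ) (a : ℝ),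
    (∃ hf : f ∈ E.domain, E.form ⟨f, hf⟩ ⟨f, hf⟩ = a) ↔
      Tendsto (fun t : ℝ => t⁻¹ * inner ℝ (f - P t f) f) (𝓝[>] 0) (𝓝 a)

end DirichletForm

/-- `p t x y` is a continuous heat kernel of `(P t)_{t > 0}`. -/
structure IsContinuousHeatKernel (μ : Measure X) (P : ℝ → Lp ℝ 2 μ →L[ℝ] Lp ℝ 2 μ)
    (p : ℝ → X → X → ℝ) : Prop where
  continuous : ∀ t : ℝ, 0 < t → Continuous fun z : X × X => p t z.1 z.2
  kernel : ∀ t : ℝ, 0 < t → ∀ f : Lp ℝ 2 μ, ∀ᵐ x ∂μ, P t f x = ∫ y, p t x y * f y ∂μ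

/-- Two-sided sub-Gaussian bounds with volume dimension `dH` and walk dimension `dW`. -/
def HasSubGaussianBounds (μ : Measure X) (dH dW : ℝ) (p : ℝ → X → X → ℝ) : Prop :=
  ∃ c₃ c₄ c₅ c₆ : ℝ, 0 < c₃ ∧ 0 < c₄ ∧ 0 < c₅ ∧ 0 < c₆ ∧
    ∀ t : ℝ, 0 < t → ∀ᵐ z ∂(μ.prod μ),
      c₅ * t ^ (-dH / dW) * Real.exp (-c₆ * (dist z.1 z.2 ^ dW / t) ^ (1 / (dW - 1)))
          ≤ p t z.1 z.2 ∧
        p t z.1 z.2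
          ≤ c₃ * t ^ (-dH / dW) * Real.exp (-c₄ * (dist z.1 z.2 ^ dW / t) ^ (1 / (dW - 1)))

/-- `η t` is the density of the `δ`-stable subordinator at time `t`: the nonnegative continuous
function on `(0, ∞)` with Laplace transform `ξ ↦ exp (-t ξ ^ δ)`. -/
structure IsStableSubordinator (δ : ℝ) (η : ℝ → ℝ → ℝ) : Prop where
  continuousOn : ∀ t : ℝ, 0 < t → ContinuousOn (η t) (Ioi 0)
  nonneg : ∀ t : ℝ, 0 < t → ∀ s : ℝ, 0 < s → 0 ≤ η t s
  laplace : ∀ t : ℝ, 0 < t → ∀ ξ : ℝ, 0 < ξ →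
    ∫ s in Ioi (0 : ℝ), η t s * Real.exp (-s * ξ) = Real.exp (-t * ξ ^ δ)

/-- The heat kernel of the subordinated semigroup `P_t^{(δ)} = ∫₀^∞ η_t(s) P_s ds`, that is
`p_t^{(δ)}(x, y) = ∫₀^∞ η_t(s) p_s(x, y) ds`. -/
noncomputable def subordinatedKernel (η : ℝ → ℝ → ℝ) (p : ℝ → X → X → ℝ)
    (t : ℝ) (x y : X) : ℝ≥0∞ :=
  ∫⁻ s in Ioi (0 : ℝ), ENNReal.ofReal (η t s * p s x y)

/-- The Besov seminorm
`‖f‖_{q,α} = sup_{t > 0} t^{-α} (∫∫ |f(x) - f(y)|^q k_t(x, y) dμ(x) dμ(y))^{1/q} ∈ [0, ∞]`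
of a kernel `k`. -/
noncomputable def besovSeminorm (μ : Measure X) (k : ℝ → X → X → ℝ≥0∞) (q α : ℝ)
    (f : X → ℝ) : ℝ≥0∞ :=
  ⨆ (t : ℝ) (_ : 0 < t), ENNReal.ofReal (t ^ (-α)) *
    (∫⁻ y, ∫⁻ x, ENNReal.ofReal (|f x - f y| ^ q) * k t x y ∂μ ∂μ) ^ (1 / q)

/-- The Besov class `B^{q,α}`: functions in `L^q` with finite seminorm. -/
def MemBesov (μ : Measure X) (k : ℝ → X → X → ℝ≥0∞) (q α : ℝ) (f : X → ℝ) : Prop :=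
  MemLp f (ENNReal.ofReal q) μ ∧ besovSeminorm μ k q α f < ∞

/-- The critical exponent `α_q^# = sup {α > 0 : B^{q,α} contains non-constant functions}`, where
constant means almost everywhere equal to a constant. -/
noncomputable def criticalExponent (μ : Measure X) (k : ℝ → X → X → ℝ≥0∞) (q : ℝ) : ℝ≥0∞ :=
  sSup {a | ∃ α : ℝ, 0 < α ∧ a = ENNReal.ofReal α ∧
    ∃ f : X → ℝ, MemBesov μ k q α f ∧ ¬ ∃ c : ℝ, ∀ᵐ x ∂μ, f x = c}

/-- The indicator function of the superlevel set `E_t(f) = {x : f x > t}`. -/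
noncomputable def levelIndicator (f : X → ℝ) (t : ℝ) : X → ℝ :=
  {x | t < f x}.indicator fun _ => 1

end FracBesov

/-! The seminorm with `q = α = 1` is comparable to a nonlocal energy, the integral of `|f x - f y|
J(x, y)` with `J = d ^ (-(dH + δ dW))`, and such an energy obeys an exact coarea formula by Tonelli.
Comparability comes from the subordinated kernel: it is at most a multiple of `t J` for all `t`
(`exists_subordinatedKernel_le`) and at least one for `t ≤ d ^ (δ dW)`
(`exists_le_subordinatedKernel`). The factor `t⁻¹` in the seminorm cancels this `t`. Above, this is
uniform in `t`; below, the region where the bound holds exhausts the off-diagonal pairs as `t → 0`.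
No asymptotics of the stable density are used. The sub-Gaussian profile in `s` is compared with
combinations of `1 - exp (-s ξ)`, whose integrals against `η t` are given exactly by the Laplace
transform. -/

namespace FracBesov

/-! ### Comparison of sub-Gaussian profiles with combinations of exponentials -/

section Elementary

theorem div_one_add_le_one_sub_exp_neg {v : ℝ} (hv : 0 ≤ v) :
    v / (1 + v) ≤ 1 - Real.exp (-v) := by
  have h1 : 0 < 1 + v := by linarith
  have h : Real.exp (-v) ≤ 1 / (1 + v) := by
    rw [Real.exp_neg, ← one_div]
    exact one_div_le_one_div_of_le h1 (by linarith [Real.add_one_le_exp v])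
  have : v / (1 + v) = 1 - 1 / (1 + v) := by field_simp; ring
  linarith

theorem one_sub_exp_neg_le (v : ℝ) : 1 - Real.exp (-v) ≤ v := by
  linarith [Real.add_one_le_exp (-v)]

theorem one_sub_exp_neg_nonneg {v : ℝ} (hv : 0 ≤ v) : 0 ≤ 1 - Real.exp (-v) := by
  linarith [Real.exp_le_one_iff.2 (neg_nonpos.2 hv)]

/-- Stretched exponentials decay faster than powers. -/
theorem exists_rpow_mul_exp_neg_le {b c β : ℝ} (hb : 0 < b) (hc : 0 < c) (hβ : 0 < β) :
    ∃ M : ℝ, 0 < M ∧ ∀ u : ℝ, 0 < u → u ^ b * Real.exp (-c * u ^ β) ≤ M := by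
  set k := b / β with hk
  have hk0 : 0 < k := div_pos hb hβ
  -- Obtained by raising `x ≤ exp x`, at `x = (c / k) u ^ β`, to the power `k = b / β`.
  refine ⟨(k / c) ^ k, by positivity, fun u hu => ?_⟩
  have hx : 0 < u ^ β := by positivity
  have h1 : c / k * u ^ β ≤ Real.exp (c / k * u ^ β) := by
    linarith [Real.add_one_le_exp (c / k * u ^ β)]
  have h2 := Real.rpow_le_rpow (by positivity) h1 hk0.le
  rw [← Real.exp_mul, Real.mul_rpow (by positivity) hx.le, ← Real.rpow_mul hu.le,
    show β * k = b by rw [hk]; field_simp, show c / k * u ^ β * k = c * u ^ β by field_simp] at h2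
  have h3 : u ^ b ≤ (k / c) ^ k * Real.exp (c * u ^ β) := by
    calc u ^ b = (k / c) ^ k * ((c / k) ^ k * u ^ b) := by
          rw [← mul_assoc, ← Real.mul_rpow (by positivity) (by positivity),
            show k / c * (c / k) = 1 by field_simp, Real.one_rpow, one_mul]
      _ ≤ _ := by gcongr
  calc u ^ b * Real.exp (-c * u ^ β)
      ≤ (k / c) ^ k * Real.exp (c * u ^ β) * Real.exp (-c * u ^ β) := by gcongr
    _ = (k / c) ^ k := by rw [mul_assoc, ← Real.exp_add]; simp

/-- The sub-Gaussian profile at scale `R` is at most a multiple of `R ^ (-a) (1 - exp (-s / R))`. -/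
theorem exists_subGaussian_le {a c β : ℝ} (ha : 0 < a) (hc : 0 < c) (hβ : 0 < β) :
    ∃ M : ℝ, 0 < M ∧ ∀ R s : ℝ, 0 < R → 0 < s →
      s ^ (-a) * Real.exp (-c * (R / s) ^ β) ≤ M * R ^ (-a) * (1 - Real.exp (-s * R⁻¹)) := by
  obtain ⟨M₁, hM₁, h₁⟩ := exists_rpow_mul_exp_neg_le ha hc hβ
  obtain ⟨M₂, hM₂, h₂⟩ := exists_rpow_mul_exp_neg_le (by linarith : 0 < a + 1) hc hβ
  -- With `u = R / s`, `1 - exp (-1 / u) ≥ 1 / (1 + u)`, so it suffices to bound `(1 + u) u ^ a exp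
  -- (-c u ^ β)`; the powers `a` and `a + 1` give the two constants.
  refine ⟨M₁ + M₂, by positivity, fun R s hR hs => ?_⟩
  have hu : 0 < R / s := by positivity
  have h3 := h₁ _ hu
  have h4 := h₂ _ hu
  rw [Real.rpow_add hu, Real.rpow_one] at h4
  have h5 := div_one_add_le_one_sub_exp_neg (v := s * R⁻¹) (by positivity)
  rw [show s * R⁻¹ / (1 + s * R⁻¹) = 1 / (1 + R / s) by field_simp; ring, ← neg_mul] at h5
  have h6 : (R / s) ^ a * Real.exp (-c * (R / s) ^ β) ≤ (M₁ + M₂) * (1 / (1 + R / s)) := by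
    rw [mul_one_div, le_div_iff₀ (by positivity)]
    linarith
  have h7 : s ^ (-a) = R ^ (-a) * (R / s) ^ a := by
    rw [Real.div_rpow hR.le hs.le, Real.rpow_neg hs.le, Real.rpow_neg hR.le]
    field_simp
  rw [h7]
  calc R ^ (-a) * (R / s) ^ a * Real.exp (-c * (R / s) ^ β)
      = R ^ (-a) * ((R / s) ^ a * Real.exp (-c * (R / s) ^ β)) := by ring
    _ ≤ R ^ (-a) * ((M₁ + M₂) * (1 - Real.exp (-s * R⁻¹))) := by
        exact mul_le_mul_of_nonneg_left (h6.trans (by gcongr)) (by positivity)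
    _ = _ := by ring

/-- A combination of the functions `1 - exp (-ξ v)` that is nonpositive off `[ε, K]`. -/
noncomputable def bump (ε K v : ℝ) : ℝ :=
  (1 - Real.exp (-v)) - 2 * (1 - Real.exp (-(v / K))) - 2 * ε * (1 - Real.exp (-(v / ε)))

theorem bump_le_one {ε K v : ℝ} (hε : 0 < ε) (hK : 0 < K) (hv : 0 < v) : bump ε K v ≤ 1 := by
  have h1 := one_sub_exp_neg_nonneg (v := v / K) (by positivity)
  have h2 := mul_nonneg hε.le (one_sub_exp_neg_nonneg (v := v / ε) (by positivity))
  have h3 := Real.exp_pos (-v)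
  unfold bump
  linarith

/-- For `v ≥ K` the second term is at least `2 * (1 / 2) = 1`, which exceeds the first. -/
theorem bump_nonpos_of_ge {ε K v : ℝ} (hε : 0 < ε) (hK : 0 < K) (hv : K ≤ v) :
    bump ε K v ≤ 0 := by
  have hv0 : 0 < v := hK.trans_le hv
  have h1 := div_one_add_le_one_sub_exp_neg (v := v / K) (by positivity)
  have h2 := mul_nonneg hε.le (one_sub_exp_neg_nonneg (v := v / ε) (by positivity))
  have h3 := Real.exp_pos (-v)
  have h4 : 1 ≤ v / K := (one_le_div hK).2 hv
  have h5 : 1 / 2 ≤ v / K / (1 + v / K) := by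
    rw [div_le_div_iff₀ two_pos (by positivity)]; linarith
  unfold bump
  linarith

/-- For `v ≤ ε` the third term is at least `v`, hence at least `1 - exp (-v)`. -/
theorem bump_nonpos_of_le {ε K v : ℝ} (hε : 0 < ε) (hK : 0 < K) (hv0 : 0 < v) (hv : v ≤ ε) :
    bump ε K v ≤ 0 := by
  have h1 := div_one_add_le_one_sub_exp_neg (v := v / ε) (by positivity)
  have h2 := one_sub_exp_neg_nonneg (v := v / K) (by positivity)
  have h3 := one_sub_exp_neg_le v
  have h4 : v / ε ≤ 1 := (div_le_one hε).2 hv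
  have h5 : v / ε / 2 ≤ v / ε / (1 + v / ε) := by gcongr; linarith
  have h6 : v / 2 ≤ ε * (1 - Real.exp (-(v / ε))) := by
    calc v / 2 = ε * (v / ε / 2) := by field_simp
      _ ≤ _ := by gcongr; linarith
  unfold bump
  linarith

/-- Off `[ε, K]` the left side is nonpositive. On it the bump is at most `1`, and both factors of
the profile are bounded below by their values at the ends of the range of `s / R`. -/
theorem exists_bump_le_subGaussian {a c β ε K : ℝ} (ha : 0 < a) (hc : 0 < c) (hβ : 0 < β)
    (hε : 0 < ε) (hK : 0 < K) :
    ∃ m : ℝ, 0 < m ∧ ∀ R s : ℝ, 0 < R → 0 < s →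
      m * R ^ (-a) * bump ε K (s / R) ≤ s ^ (-a) * Real.exp (-c * (R / s) ^ β) := by
  refine ⟨K ^ (-a) * Real.exp (-c * (ε⁻¹) ^ β), by positivity, fun R s hR hs => ?_⟩
  have hv : 0 < s / R := by positivity
  have hpos : 0 ≤ s ^ (-a) * Real.exp (-c * (R / s) ^ β) := by positivity
  have hm : 0 ≤ K ^ (-a) * Real.exp (-c * (ε⁻¹) ^ β) * R ^ (-a) := by positivity
  rcases le_total K (s / R) with h | h
  · exact (mul_nonpos_of_nonneg_of_nonpos hm (bump_nonpos_of_ge hε hK h)).trans hpos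
  rcases le_total (s / R) ε with h' | h'
  · exact (mul_nonpos_of_nonneg_of_nonpos hm (bump_nonpos_of_le hε hK hv h')).trans hpos
  refine (mul_le_of_le_one_right hm (bump_le_one hε hK hv)).trans ?_
  have h1 : s ≤ K * R := (div_le_iff₀ hR).1 h
  have h2 : R / s ≤ ε⁻¹ := by
    rw [← inv_div]; exact inv_anti₀ hε h'
  have h3 : (K * R) ^ (-a) ≤ s ^ (-a) :=
    Real.rpow_le_rpow_of_nonpos hs h1 (by linarith)
  have h4 : (R / s) ^ β ≤ (ε⁻¹) ^ β := Real.rpow_le_rpow (by positivity) h2 hβ.le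
  calc K ^ (-a) * Real.exp (-c * (ε⁻¹) ^ β) * R ^ (-a)
      = (K * R) ^ (-a) * Real.exp (-c * (ε⁻¹) ^ β) := by
        rw [Real.mul_rpow hK.le hR.le]; ring
    _ ≤ s ^ (-a) * Real.exp (-c * (R / s) ^ β) := by
        refine mul_le_mul h3 (Real.exp_le_exp.2 ?_) (Real.exp_pos _).le (by positivity)
        rw [neg_mul, neg_mul]
        gcongr

end Elementary

/-! ### Mass and jump intensity of the subordinator from its Laplace transform -/

namespace IsStableSubordinator

variable {δ : ℝ} {η : ℝ → ℝ → ℝ}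

/-- A non-integrable function has Bochner integral `0` by convention, whereas the Laplace transform
is positive. -/
theorem integrableOn_mul_exp (hη : IsStableSubordinator δ η) {t ξ : ℝ} (ht : 0 < t) (hξ : 0 < ξ) :
    IntegrableOn (fun s => η t s * Real.exp (-s * ξ)) (Ioi 0) := by
  by_contra h
  have h1 := hη.laplace t ht ξ hξ
  rw [integral_undef h] at h1
  exact (Real.exp_pos _).ne h1

theorem aestronglyMeasurable (hη : IsStableSubordinator δ η) {t : ℝ} (ht : 0 < t) :
    AEStronglyMeasurable (η t) (volume.restrict (Ioi 0)) :=
  (hη.continuousOn t ht).aestronglyMeasurable measurableSet_Ioi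

/-- Let `ξ = 1 / (n + 1)` decrease to `0` in the Laplace transform: monotone convergence on the
left, `ξ ^ δ → 0` on the right. -/
theorem lintegral_eq_one (hη : IsStableSubordinator δ η) (hδ : 0 < δ) {t : ℝ} (ht : 0 < t) :
    ∫⁻ s in Ioi (0 : ℝ), ENNReal.ofReal (η t s) = 1 := by
  have hpos : ∀ n : ℕ, (0 : ℝ) < 1 / ((n : ℝ) + 1) := fun n => by positivity
  have hint : ∀ n : ℕ, ∫⁻ s in Ioi (0 : ℝ),
      ENNReal.ofReal (η t s * Real.exp (-s * (1 / ((n : ℝ) + 1))))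
        = ENNReal.ofReal (Real.exp (-t * (1 / ((n : ℝ) + 1)) ^ δ)) := by
    intro n
    rw [← hη.laplace t ht _ (hpos n),
      ofReal_integral_eq_lintegral_ofReal (hη.integrableOn_mul_exp ht (hpos n))]
    filter_upwards [ae_restrict_mem measurableSet_Ioi] with s hs
    exact mul_nonneg (hη.nonneg t ht s hs) (Real.exp_pos _).le
  have hlim : Tendsto (fun n : ℕ => 1 / ((n : ℝ) + 1)) atTop (𝓝 0) :=
    tendsto_one_div_add_atTop_nhds_zero_nat
  have h1 : Tendsto (fun n : ℕ => ∫⁻ s in Ioi (0 : ℝ),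
      ENNReal.ofReal (η t s * Real.exp (-s * (1 / ((n : ℝ) + 1))))) atTop
      (𝓝 (∫⁻ s in Ioi (0 : ℝ), ENNReal.ofReal (η t s))) := by
    refine lintegral_tendsto_of_tendsto_of_monotone ?_ ?_ ?_
    · exact fun n => (hη.integrableOn_mul_exp ht (hpos n)).1.aemeasurable.ennreal_ofReal
    · filter_upwards [ae_restrict_mem measurableSet_Ioi] with s hs
      intro m n hmn
      have h0 := hη.nonneg t ht s hs
      have h2 : 1 / ((n : ℝ) + 1) ≤ 1 / ((m : ℝ) + 1) := by gcongr
      have h3 : (0 : ℝ) < s := hs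
      dsimp only
      gcongr ENNReal.ofReal (_ * Real.exp ?_)
      nlinarith
    · filter_upwards with s
      refine (ENNReal.continuous_ofReal.tendsto _).comp ?_
      have : Tendsto (fun n : ℕ => η t s * Real.exp (-s * (1 / ((n : ℝ) + 1)))) atTop
          (𝓝 (η t s * Real.exp (-s * 0))) :=
        ((Real.continuous_exp.tendsto _).comp (hlim.const_mul _)).const_mul _
      simpa using this
  have h2 : Tendsto (fun n : ℕ => ENNReal.ofReal (Real.exp (-t * (1 / ((n : ℝ) + 1)) ^ δ))) atTop
      (𝓝 1) := by
    have h3 : Tendsto (fun n : ℕ => (1 / ((n : ℝ) + 1)) ^ δ) atTop (𝓝 0) := by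
      have := hlim.rpow_const (p := δ) (Or.inr hδ.le)
      rwa [Real.zero_rpow hδ.ne'] at this
    have h4 := (ENNReal.continuous_ofReal.tendsto _).comp
      ((Real.continuous_exp.tendsto _).comp (h3.const_mul (-t)))
    simpa [Function.comp_def] using h4
  simp only [hint] at h1
  exact tendsto_nhds_unique h1 h2

theorem integrableOn (hη : IsStableSubordinator δ η) (hδ : 0 < δ) {t : ℝ} (ht : 0 < t) :
    IntegrableOn (η t) (Ioi 0) := by
  refine ⟨hη.aestronglyMeasurable ht, ?_⟩
  rw [hasFiniteIntegral_iff_ofReal, hη.lintegral_eq_one hδ ht]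
  · exact ENNReal.one_lt_top
  · filter_upwards [ae_restrict_mem measurableSet_Ioi] with s hs using hη.nonneg t ht s hs

theorem integral_eq_one (hη : IsStableSubordinator δ η) (hδ : 0 < δ) {t : ℝ} (ht : 0 < t) :
    ∫ s in Ioi (0 : ℝ), η t s = 1 := by
  rw [integral_eq_lintegral_of_nonneg_ae _ (hη.aestronglyMeasurable ht),
    hη.lintegral_eq_one hδ ht, ENNReal.toReal_one]
  filter_upwards [ae_restrict_mem measurableSet_Ioi] with s hs using hη.nonneg t ht s hs

theorem integrableOn_one_sub_exp (hη : IsStableSubordinator δ η) (hδ : 0 < δ) {t ξ : ℝ}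
    (ht : 0 < t) (hξ : 0 < ξ) :
    IntegrableOn (fun s => η t s * (1 - Real.exp (-s * ξ))) (Ioi 0) := by
  simp only [mul_sub, mul_one]
  exact (hη.integrableOn hδ ht).sub (hη.integrableOn_mul_exp ht hξ)

theorem integral_one_sub_exp (hη : IsStableSubordinator δ η) (hδ : 0 < δ) {t ξ : ℝ}
    (ht : 0 < t) (hξ : 0 < ξ) :
    ∫ s in Ioi (0 : ℝ), η t s * (1 - Real.exp (-s * ξ)) = 1 - Real.exp (-t * ξ ^ δ) := by
  simp only [mul_sub, mul_one]
  rw [integral_sub (hη.integrableOn hδ ht) (hη.integrableOn_mul_exp ht hξ),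
    hη.integral_eq_one hδ ht, hη.laplace t ht ξ hξ]

theorem mul_bump_eq (ε K R t s : ℝ) :
    η t s * bump ε K (s / R) = η t s * (1 - Real.exp (-s * R⁻¹))
      - 2 * (η t s * (1 - Real.exp (-s * (K * R)⁻¹)))
      - 2 * ε * (η t s * (1 - Real.exp (-s * (ε * R)⁻¹))) := by
  unfold bump
  rw [show -(s / R) = -s * R⁻¹ by ring, show -(s / R / K) = -s * (K * R)⁻¹ by
    rw [mul_inv]; ring, show -(s / R / ε) = -s * (ε * R)⁻¹ by rw [mul_inv]; ring]
  ring

theorem integrableOn_bump (hη : IsStableSubordinator δ η) (hδ : 0 < δ) {t ε K R : ℝ}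
    (ht : 0 < t) (hε : 0 < ε) (hK : 0 < K) (hR : 0 < R) :
    IntegrableOn (fun s => η t s * bump ε K (s / R)) (Ioi 0) := by
  simp only [mul_bump_eq]
  exact ((hη.integrableOn_one_sub_exp hδ ht (by positivity)).sub
    ((hη.integrableOn_one_sub_exp hδ ht (by positivity)).const_mul _)).sub
    ((hη.integrableOn_one_sub_exp hδ ht (by positivity)).const_mul _)

/-- At scales `R ^ δ ≥ t` the jump intensity seen by a bump with suitable fixed cutoffs
is comparable to `t R ^ (-δ)`. -/
theorem exists_le_integral_bump (hη : IsStableSubordinator δ η) (hδ : 0 < δ) (hδ1 : δ < 1) :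
    ∃ ε K : ℝ, 0 < ε ∧ 0 < K ∧ ∀ t R : ℝ, 0 < t → 0 < R → t ≤ R ^ δ →
      t * R ^ (-δ) / 4 ≤ ∫ s in Ioi (0 : ℝ), η t s * bump ε K (s / R) := by
  have hδ' : 0 < 1 - δ := by linarith
  -- The cutoffs solve `ε ^ (1 - δ) = 1 / 16` and `K ^ (-δ) = 1 / 16`; the first needs `δ < 1`. With
  -- `τ = t R ^ (-δ) ≤ 1`, the main term is at least `τ / 2` and each of the two corrections costs
  -- at most `τ / 8`, leaving `τ / 4`.
  set ε : ℝ := (1 / 16 : ℝ) ^ (1 / (1 - δ)) with hεdef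
  set K : ℝ := (1 / 16 : ℝ) ^ (-(1 / δ)) with hKdef
  have hε : 0 < ε := by positivity
  have hK : 0 < K := by positivity
  have hK' : K ^ (-δ) = 1 / 16 := by
    rw [hKdef, ← Real.rpow_mul (by norm_num), show -(1 / δ) * -δ = 1 by field_simp,
      Real.rpow_one]
  have hε' : ε * ε ^ (-δ) = 1 / 16 := by
    nth_rewrite 1 [← Real.rpow_one ε]
    rw [← Real.rpow_add hε, hεdef, ← Real.rpow_mul (by norm_num),
      show 1 / (1 - δ) * (1 + -δ) = 1 by rw [← sub_eq_add_neg]; field_simp, Real.rpow_one]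
  refine ⟨ε, K, hε, hK, fun t R ht hR htR => ?_⟩
  have hRi : ∀ c : ℝ, 0 < c → (c⁻¹) ^ δ = c ^ (-δ) := fun c hc => by
    rw [Real.inv_rpow hc.le, Real.rpow_neg hc.le]
  have i1 := hη.integrableOn_one_sub_exp hδ ht (inv_pos.2 hR)
  have i2 := hη.integrableOn_one_sub_exp hδ ht (inv_pos.2 (mul_pos hK hR))
  have i3 := hη.integrableOn_one_sub_exp hδ ht (inv_pos.2 (mul_pos hε hR))
  simp only [mul_bump_eq]
  have i12 : IntegrableOn (fun s => η t s * (1 - Real.exp (-s * R⁻¹))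
      - 2 * (η t s * (1 - Real.exp (-s * (K * R)⁻¹)))) (Ioi 0) := i1.sub (i2.const_mul _)
  rw [integral_sub i12 (i3.const_mul _), integral_sub i1 (i2.const_mul _), integral_const_mul, integral_const_mul, hη.integral_one_sub_exp hδ ht (inv_pos.2 hR),
    hη.integral_one_sub_exp hδ ht (inv_pos.2 (mul_pos hK hR)),
    hη.integral_one_sub_exp hδ ht (inv_pos.2 (mul_pos hε hR)), hRi _ hR, hRi _ (mul_pos hK hR),
    hRi _ (mul_pos hε hR), Real.mul_rpow hK.le hR.le, Real.mul_rpow hε.le hR.le, hK', neg_mul,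
    neg_mul, neg_mul]
  set τ := t * R ^ (-δ) with hτ
  have hτ0 : 0 < τ := by positivity
  have hτ1 : τ ≤ 1 := by
    rw [hτ, Real.rpow_neg hR.le, ← div_eq_mul_inv]
    exact (div_le_one (by positivity)).2 htR
  have e1 : τ / 2 ≤ 1 - Real.exp (-τ) :=
    le_trans (by gcongr; linarith) (div_one_add_le_one_sub_exp_neg hτ0.le)
  have e2 : 1 - Real.exp (-(t * (1 / 16 * R ^ (-δ)))) ≤ τ / 16 :=
    (one_sub_exp_neg_le _).trans_eq (by rw [hτ]; ring)
  have e3 : ε * (1 - Real.exp (-(t * (ε ^ (-δ) * R ^ (-δ))))) ≤ τ / 16 := by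
    calc _ ≤ ε * (t * (ε ^ (-δ) * R ^ (-δ))) := by gcongr; exact one_sub_exp_neg_le _
      _ = ε * ε ^ (-δ) * τ := by rw [hτ]; ring
      _ = τ / 16 := by rw [hε']; ring
  linarith

end IsStableSubordinator

/-! ### Two-sided bounds for the subordinated kernel -/

section Kernel

variable {X : Type*} [MetricSpace X]

/-- The sub-Gaussian bounds hold at every pair of points, since both sides are continuous. -/
theorem HasSubGaussianBounds.forall [MeasurableSpace X] [OpensMeasurableSpace X] {μ : Measure X}
    [(μ.prod μ).IsOpenPosMeasure] {dH dW : ℝ} (hdW : 2 ≤ dW) {p : ℝ → X → X → ℝ}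
    (hp : ∀ t : ℝ, 0 < t → Continuous fun z : X × X => p t z.1 z.2)
    (h : HasSubGaussianBounds μ dH dW p) :
    ∃ c₃ c₄ c₅ c₆ : ℝ, 0 < c₃ ∧ 0 < c₄ ∧ 0 < c₅ ∧ 0 < c₆ ∧
      ∀ t : ℝ, 0 < t → ∀ x y : X,
        c₅ * t ^ (-dH / dW) * Real.exp (-c₆ * (dist x y ^ dW / t) ^ (1 / (dW - 1))) ≤ p t x y ∧
          p t x y
            ≤ c₃ * t ^ (-dH / dW) * Real.exp (-c₄ * (dist x y ^ dW / t) ^ (1 / (dW - 1))) := by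
  obtain ⟨c₃, c₄, c₅, c₆, h3, h4, h5, h6, hb⟩ := h
  refine ⟨c₃, c₄, c₅, c₆, h3, h4, h5, h6, fun t ht x y => ?_⟩
  have hcont : ∀ A c : ℝ, Continuous fun z : X × X =>
      A * Real.exp (-c * (dist z.1 z.2 ^ dW / t) ^ (1 / (dW - 1))) := by
    intro A c
    have h1 : Continuous fun z : X × X => dist z.1 z.2 ^ dW / t :=
      (continuous_dist.rpow_const fun _ => Or.inr (by linarith)).div_const _
    have h2 : (0 : ℝ) ≤ 1 / (dW - 1) := one_div_nonneg.2 (by linarith)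
    exact continuous_const.mul (Real.continuous_exp.comp
      (continuous_const.mul (h1.rpow_const fun _ => Or.inr h2)))
  have hclosed : IsClosed {z : X × X |
      c₅ * t ^ (-dH / dW) * Real.exp (-c₆ * (dist z.1 z.2 ^ dW / t) ^ (1 / (dW - 1)))
          ≤ p t z.1 z.2 ∧
        p t z.1 z.2
          ≤ c₃ * t ^ (-dH / dW) * Real.exp (-c₄ * (dist z.1 z.2 ^ dW / t) ^ (1 / (dW - 1)))} :=
    (isClosed_le (hcont _ _) (hp t ht)).inter (isClosed_le (hp t ht) (hcont _ _))
  have hd := (Measure.dense_of_ae (hb t ht)).closure_eq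
  rw [hclosed.closure_eq] at hd
  have : (x, y) ∈ (univ : Set (X × X)) := mem_univ _
  rw [← hd] at this
  exact this

/-- The subordinated kernel is at most a multiple of `t d(x, y) ^ (-(dH + δ dW))`. -/
theorem exists_subordinatedKernel_le {dH dW δ c₃ c₄ : ℝ} (hdH : 0 < dH) (hdW : 2 ≤ dW)
    (hδ : 0 < δ) {η : ℝ → ℝ → ℝ} (hη : IsStableSubordinator δ η) (h3 : 0 < c₃) (h4 : 0 < c₄)
    {p : ℝ → X → X → ℝ}
    (hp : ∀ t : ℝ, 0 < t → ∀ x y : X, p t x y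
      ≤ c₃ * t ^ (-dH / dW) * Real.exp (-c₄ * (dist x y ^ dW / t) ^ (1 / (dW - 1)))) :
    ∃ C : ℝ, 0 < C ∧ ∀ t : ℝ, 0 < t → ∀ x y : X, x ≠ y →
      subordinatedKernel η p t x y
        ≤ ENNReal.ofReal (C * (t * dist x y ^ (-(dH + δ * dW)))) := by
  have hdW0 : 0 < dW := by linarith
  obtain ⟨M, hM, hle⟩ := exists_subGaussian_le (div_pos hdH hdW0) h4
    (one_div_pos.2 (by linarith : 0 < dW - 1))
  refine ⟨c₃ * M, by positivity, fun t ht x y hxy => ?_⟩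
  have hr : 0 < dist x y := dist_pos.2 hxy
  -- `R` is the time the diffusion needs to cover the distance `d(x, y)`, the natural scale for `s`.
  set R := dist x y ^ dW with hRdef
  have hR : 0 < R := by positivity
  have hRpow : R ^ (-(dH / dW)) * R ^ (-δ) = dist x y ^ (-(dH + δ * dW)) := by
    rw [← Real.rpow_add hR, hRdef, ← Real.rpow_mul hr.le]
    congr 1
    field_simp
    ring
  set A := c₃ * M * R ^ (-(dH / dW)) with hA
  have hA0 : 0 ≤ A := by positivity
  have hint := (hη.integrableOn_one_sub_exp hδ ht (inv_pos.2 hR)).const_mul A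
  calc subordinatedKernel η p t x y
      ≤ ∫⁻ s in Ioi (0 : ℝ), ENNReal.ofReal (A * (η t s * (1 - Real.exp (-s * R⁻¹)))) := by
        refine setLIntegral_mono' measurableSet_Ioi fun s hs => ENNReal.ofReal_le_ofReal ?_
        have hs0 : (0 : ℝ) < s := hs
        calc η t s * p s x y
            ≤ η t s * (c₃ * (M * R ^ (-(dH / dW)) * (1 - Real.exp (-s * R⁻¹)))) := by
              refine mul_le_mul_of_nonneg_left ?_ (hη.nonneg t ht s hs)
              refine (hp s hs0 x y).trans ?_
              rw [neg_div, mul_assoc]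
              exact mul_le_mul_of_nonneg_left (hle R s hR hs0) h3.le
          _ = _ := by rw [hA]; ring
    _ = ENNReal.ofReal (∫ s in Ioi (0 : ℝ), A * (η t s * (1 - Real.exp (-s * R⁻¹)))) := by
        rw [ofReal_integral_eq_lintegral_ofReal hint]
        filter_upwards [ae_restrict_mem measurableSet_Ioi] with s hs
        have hs0 : (0 : ℝ) < s := hs
        refine mul_nonneg hA0 (mul_nonneg (hη.nonneg t ht s hs) ?_)
        rw [neg_mul]
        exact one_sub_exp_neg_nonneg (by positivity)
    _ ≤ _ := by
        refine ENNReal.ofReal_le_ofReal ?_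
        rw [integral_const_mul, hη.integral_one_sub_exp hδ ht (inv_pos.2 hR), neg_mul]
        calc A * (1 - Real.exp (-(t * R⁻¹ ^ δ))) ≤ A * (t * R⁻¹ ^ δ) := by
              gcongr; exact one_sub_exp_neg_le _
          _ = c₃ * M * (t * (R ^ (-(dH / dW)) * R ^ (-δ))) := by
              rw [hA, Real.inv_rpow hR.le, ← Real.rpow_neg hR.le]; ring
          _ = _ := by rw [hRpow]

/-- Discards the negative part; needed because the bump integrand changes sign. -/
theorem ofReal_integral_le_lintegral_ofReal {α : Type*} [MeasurableSpace α] {ν : Measure α}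
    {f : α → ℝ} (hf : Integrable f ν) :
    ENNReal.ofReal (∫ a, f a ∂ν) ≤ ∫⁻ a, ENNReal.ofReal (f a) ∂ν := by
  rw [integral_eq_lintegral_pos_part_sub_lintegral_neg_part hf]
  exact (ENNReal.ofReal_le_ofReal (sub_le_self _ ENNReal.toReal_nonneg)).trans
    ENNReal.ofReal_toReal_le

/-- The subordinated kernel is at least a multiple of `t d(x, y) ^ (-(dH + δ dW))` for
`t ≤ d(x, y) ^ (δ dW)`. -/
theorem exists_le_subordinatedKernel {dH dW δ c₅ c₆ : ℝ} (hdH : 0 < dH) (hdW : 2 ≤ dW)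
    (hδ : 0 < δ) (hδ1 : δ < 1) {η : ℝ → ℝ → ℝ} (hη : IsStableSubordinator δ η) (h5 : 0 < c₅)
    (h6 : 0 < c₆) {p : ℝ → X → X → ℝ}
    (hp : ∀ t : ℝ, 0 < t → ∀ x y : X,
      c₅ * t ^ (-dH / dW) * Real.exp (-c₆ * (dist x y ^ dW / t) ^ (1 / (dW - 1))) ≤ p t x y) :
    ∃ c : ℝ, 0 < c ∧ ∀ t : ℝ, 0 < t → ∀ x y : X, x ≠ y → t ≤ dist x y ^ (dW * δ) →
      ENNReal.ofReal (c * (t * dist x y ^ (-(dH + δ * dW))))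
        ≤ subordinatedKernel η p t x y := by
  have hdW0 : 0 < dW := by linarith
  obtain ⟨ε, K, hε, hK, hbump⟩ := hη.exists_le_integral_bump hδ hδ1
  obtain ⟨m, hm, hle⟩ := exists_bump_le_subGaussian (div_pos hdH hdW0) h6
    (one_div_pos.2 (by linarith : 0 < dW - 1)) hε hK
  refine ⟨c₅ * m / 4, by positivity, fun t ht x y hxy htd => ?_⟩
  have hr : 0 < dist x y := dist_pos.2 hxy
  rw [Real.rpow_mul hr.le] at htd
  set R := dist x y ^ dW with hRdef
  have hR : 0 < R := by positivity
  have hRpow : R ^ (-(dH / dW)) * R ^ (-δ) = dist x y ^ (-(dH + δ * dW)) := by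
    rw [← Real.rpow_add hR, hRdef, ← Real.rpow_mul hr.le]
    congr 1
    field_simp
    ring
  set A := c₅ * m * R ^ (-(dH / dW)) with hA
  have hA0 : 0 ≤ A := by positivity
  have hint := (hη.integrableOn_bump hδ ht hε hK hR).const_mul A
  calc ENNReal.ofReal (c₅ * m / 4 * (t * dist x y ^ (-(dH + δ * dW))))
      = ENNReal.ofReal (A * (t * R ^ (-δ) / 4)) := by rw [← hRpow, hA]; congr 1; ring
    _ ≤ ENNReal.ofReal (∫ s in Ioi (0 : ℝ), A * (η t s * bump ε K (s / R))) := by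
        rw [integral_const_mul]
        exact ENNReal.ofReal_le_ofReal (mul_le_mul_of_nonneg_left (hbump t R ht hR htd) hA0)
    _ ≤ ∫⁻ s in Ioi (0 : ℝ), ENNReal.ofReal (A * (η t s * bump ε K (s / R))) :=
        ofReal_integral_le_lintegral_ofReal hint
    _ ≤ subordinatedKernel η p t x y := by
        refine setLIntegral_mono' measurableSet_Ioi fun s hs => ENNReal.ofReal_le_ofReal ?_
        have hs0 : (0 : ℝ) < s := hs
        calc A * (η t s * bump ε K (s / R))
            = η t s * (c₅ * (m * R ^ (-(dH / dW)) * bump ε K (s / R))) := by rw [hA]; ring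
          _ ≤ η t s * p s x y := by
              refine mul_le_mul_of_nonneg_left (le_trans ?_ (hp s hs0 x y))
                (hη.nonneg t ht s hs)
              rw [neg_div, mul_assoc c₅]
              exact mul_le_mul_of_nonneg_left (hle R s hR hs0) h5.le

end Kernel

/-! ### Coarea formula for nonlocal energies -/

section Coarea

variable {X : Type*} [MeasurableSpace X]

/-- The nonlocal energy `∬ |f x - f y| J(x, y) dμ(x) dμ(y)` with jump kernel `J`. -/
noncomputable def jumpEnergy (μ : Measure X) (J : X × X → ℝ≥0∞) (f : X → ℝ) : ℝ≥0∞ :=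
  ∫⁻ z, ENNReal.ofReal |f z.1 - f z.2| * J z ∂(μ.prod μ)

/-- For `b ≤ a` the integrand is the indicator of those `t > 0` with `b ≤ t < a`. Restricting to `t
> 0` is what produces positive parts. -/
theorem lintegral_abs_sub_indicator (a b : ℝ) :
    ∫⁻ t in Ioi (0 : ℝ), ENNReal.ofReal
        |(if t < a then (1 : ℝ) else 0) - (if t < b then (1 : ℝ) else 0)|
      = ENNReal.ofReal |max a 0 - max b 0| := by
  wlog hab : b ≤ a generalizing a b
  · rw [abs_sub_comm, ← this b a (le_of_not_ge hab)]
    simp only [abs_sub_comm]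
  have h1 : ∀ t ∈ Ioi (0 : ℝ), ENNReal.ofReal
      |(if t < a then (1 : ℝ) else 0) - (if t < b then (1 : ℝ) else 0)|
        = (Ico (max b 0) (max a 0)).indicator 1 t := by
    intro t ht
    have ht0 : (0 : ℝ) < t := ht
    by_cases h2 : t < a <;> by_cases h3 : t < b
    · simp [indicator, h2, h3]
    · simp [indicator, h2, h3, ht0.le, not_lt.1 h3]
    · exact absurd (h3.trans_le hab) h2
    · simp [indicator, h2, h3, ht0.not_gt]
  rw [setLIntegral_congr_fun measurableSet_Ioi h1, lintegral_indicator_one measurableSet_Ico,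
    Measure.restrict_apply measurableSet_Ico, abs_of_nonneg (sub_nonneg.2 (by gcongr))]
  -- Intersecting with `Ioi 0` can remove only the endpoint `0`, so the set lies between `Ioo` and
  -- `Ico`, which have equal length.
  have h4 : Ioo (max b 0) (max a 0) ⊆ Ico (max b 0) (max a 0) ∩ Ioi 0 := fun t ht =>
    ⟨⟨ht.1.le, ht.2⟩, (le_max_right b 0).trans_lt ht.1⟩
  refine le_antisymm ((measure_mono inter_subset_left).trans Real.volume_Ico.le) ?_
  rw [← Real.volume_Ioo]
  exact measure_mono h4

theorem measurable_levelIndicator_uncurry {f : X → ℝ} (hf : Measurable f) :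
    Measurable fun q : ℝ × X => levelIndicator f q.1 q.2 := by
  have : (fun q : ℝ × X => levelIndicator f q.1 q.2)
      = {q : ℝ × X | q.1 < f q.2}.indicator fun _ => 1 := by
    ext q; simp [levelIndicator, indicator]
  rw [this]
  exact measurable_const.indicator (measurableSet_lt measurable_fst (hf.comp measurable_snd))

theorem measurable_levelIndicator {f : X → ℝ} (hf : Measurable f) (t : ℝ) :
    Measurable (levelIndicator f t) :=
  (measurable_levelIndicator_uncurry hf).comp measurable_prodMk_left

theorem measurable_coarea_integrand {J : X × X → ℝ≥0∞} (hJ : Measurable J) {f : X → ℝ}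
    (hf : Measurable f) :
    Measurable fun q : ℝ × (X × X) =>
      ENNReal.ofReal |levelIndicator f q.1 q.2.1 - levelIndicator f q.1 q.2.2| * J q.2 := by
  have h := measurable_levelIndicator_uncurry hf
  have h1 := h.comp (measurable_fst.prodMk (measurable_fst.comp measurable_snd) :
    Measurable fun q : ℝ × (X × X) => (q.1, q.2.1))
  have h2 := h.comp (measurable_fst.prodMk (measurable_snd.comp measurable_snd) :
    Measurable fun q : ℝ × (X × X) => (q.1, q.2.2))
  have h3 := (continuous_abs.measurable.comp (h1.sub h2)).ennreal_ofReal
  exact h3.mul (hJ.comp measurable_snd)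

theorem measurable_jumpEnergy_levelIndicator (μ : Measure X) [SFinite μ] {J : X × X → ℝ≥0∞}
    (hJ : Measurable J) {f : X → ℝ} (hf : Measurable f) :
    Measurable fun t => jumpEnergy μ J (levelIndicator f t) :=
  (measurable_coarea_integrand hJ hf).lintegral_prod_right'

/-- Coarea formula for the nonlocal energy. -/
theorem lintegral_jumpEnergy_levelIndicator (μ : Measure X) [SFinite μ] {J : X × X → ℝ≥0∞}
    (hJ : Measurable J) {f : X → ℝ} (hf : Measurable f) :
    ∫⁻ t in Ioi (0 : ℝ), jumpEnergy μ J (levelIndicator f t)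
      = jumpEnergy μ J fun x => max (f x) 0 := by
  unfold jumpEnergy
  rw [lintegral_lintegral_swap (measurable_coarea_integrand hJ hf).aemeasurable]
  refine lintegral_congr fun z => ?_
  have hm : Measurable fun t : ℝ =>
      ENNReal.ofReal |levelIndicator f t z.1 - levelIndicator f t z.2| := by
    have h := fun x : X => (measurable_levelIndicator_uncurry hf).comp
      (measurable_prodMk_right (y := x) : Measurable fun t : ℝ => (t, x))
    exact (continuous_abs.measurable.comp ((h z.1).sub (h z.2))).ennreal_ofReal
  rw [lintegral_mul_const _ hm, ← lintegral_abs_sub_indicator]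
  simp [levelIndicator, indicator]

/-- The positive part is 1-Lipschitz. This handles sign-changing `f` in the second assertion. -/
theorem jumpEnergy_posPart_le (μ : Measure X) (J : X × X → ℝ≥0∞) (f : X → ℝ) :
    jumpEnergy μ J (fun x => max (f x) 0) ≤ jumpEnergy μ J f := by
  refine lintegral_mono fun z => ?_
  dsimp only
  gcongr ENNReal.ofReal ?_ * _
  exact abs_max_sub_max_le_abs _ _ _

theorem besovSeminorm_one_one (μ : Measure X) (k : ℝ → X → X → ℝ≥0∞) (f : X → ℝ) :
    besovSeminorm μ k 1 1 f = ⨆ (t : ℝ) (_ : 0 < t), ENNReal.ofReal t⁻¹ *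
      ∫⁻ y, ∫⁻ x, ENNReal.ofReal |f x - f y| * k t x y ∂μ ∂μ := by
  simp [besovSeminorm, Real.rpow_neg_one]

theorem besovSeminorm_congr_ae {μ : Measure X} (k : ℝ → X → X → ℝ≥0∞) (q α : ℝ) {f g : X → ℝ}
    (h : f =ᵐ[μ] g) : besovSeminorm μ k q α f = besovSeminorm μ k q α g := by
  unfold besovSeminorm
  refine iSup_congr fun t => iSup_congr fun _ => ?_
  congr 2
  refine lintegral_congr_ae ?_
  filter_upwards [h] with y hy
  refine lintegral_congr_ae ?_
  filter_upwards [h] with x hx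
  rw [hx, hy]

theorem levelIndicator_congr_ae {μ : Measure X} {f g : X → ℝ} (h : f =ᵐ[μ] g) (t : ℝ) :
    levelIndicator f t =ᵐ[μ] levelIndicator g t := by
  filter_upwards [h] with x hx
  simp [levelIndicator, indicator, hx]

/-- By Markov's inequality an integrable function has superlevel sets of finite measure at every
height `t > 0`. -/
theorem memLp_levelIndicator {μ : Measure X} {f : X → ℝ} (hf : MemLp f 1 μ) {t : ℝ} (ht : 0 < t) :
    MemLp (levelIndicator f t) 1 μ := by
  have hfi := memLp_one_iff_integrable.1 hf
  have hg := hfi.1.aemeasurable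
  have hset : {x | t < f x} =ᵐ[μ] {x | t < hg.mk f x} := by
    filter_upwards [hg.ae_eq_mk] with x hx
    exact propext (show t < f x ↔ t < hg.mk f x by rw [hx])
  have hm : MeasurableSet {x | t < hg.mk f x} := measurableSet_lt measurable_const hg.measurable_mk
  refine (memLp_congr_ae (levelIndicator_congr_ae hg.ae_eq_mk t)).2 ?_
  refine memLp_indicator_const 1 hm 1 (Or.inr ?_)
  rw [← measure_congr hset]
  refine ((measure_mono fun x hx => ?_).trans_lt (hfi.measure_ge_lt_top ht)).ne
  exact le_of_lt (show t < f x from hx)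

end Coarea

/-! ### Comparability of the seminorm with the energy, and its consequences -/

section Seminorm

variable {X : Type*} [MeasurableSpace X]
variable {μ : Measure X} {k : ℝ → X → X → ℝ≥0∞} {J : X × X → ℝ≥0∞} {f : X → ℝ}

/-- The bound on `k` is needed only off the diagonal, where `f x - f y` can be nonzero. Tonelli is
applied to the majorant, so `k` need not be measurable. -/
theorem besovSeminorm_le_jumpEnergy [SFinite μ] {C : ℝ≥0∞} (hJ : Measurable J)
    (hk : ∀ t : ℝ, 0 < t → ∀ x y : X, x ≠ y → k t x y ≤ ENNReal.ofReal t * (C * J (x, y)))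
    (hf : Measurable f) :
    besovSeminorm μ k 1 1 f ≤ C * jumpEnergy μ J f := by
  have hm : Measurable fun z : X × X => ENNReal.ofReal |f z.1 - f z.2| * J z :=
    (continuous_abs.measurable.comp
      ((hf.comp measurable_fst).sub (hf.comp measurable_snd))).ennreal_ofReal.mul hJ
  rw [besovSeminorm_one_one]
  refine iSup₂_le fun t ht => ?_
  have h1 : ∫⁻ y, ∫⁻ x, ENNReal.ofReal |f x - f y| * k t x y ∂μ ∂μ
      ≤ ∫⁻ y, ∫⁻ x, ENNReal.ofReal t * C * (ENNReal.ofReal |f x - f y| * J (x, y)) ∂μ ∂μ := by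
    refine lintegral_mono fun y => lintegral_mono fun x => ?_
    rcases eq_or_ne x y with rfl | hxy
    · simp
    · calc ENNReal.ofReal |f x - f y| * k t x y
          ≤ ENNReal.ofReal |f x - f y| * (ENNReal.ofReal t * (C * J (x, y))) := by
            gcongr; exact hk t ht x y hxy
        _ = _ := by ring
  rw [← lintegral_prod_symm (fun z : X × X =>
      ENNReal.ofReal t * C * (ENNReal.ofReal |f z.1 - f z.2| * J z)) (hm.const_mul _).aemeasurable,
    lintegral_const_mul _ hm] at h1
  calc _ ≤ ENNReal.ofReal t⁻¹ * (ENNReal.ofReal t * C * jumpEnergy μ J f) := by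
        gcongr; exact h1
    _ = (ENNReal.ofReal t⁻¹ * ENNReal.ofReal t) * (C * jumpEnergy μ J f) := by ring
    _ = C * jumpEnergy μ J f := by
        rw [← ENNReal.ofReal_mul (by positivity), inv_mul_cancel₀ ht.ne', ENNReal.ofReal_one,
          one_mul]

/-- At the single time `T n` the seminorm controls the energy over the pairs with `T n ≤ d ^ b`.
These sets increase to the off-diagonal as `T n → 0`, and monotone convergence recovers the full
energy. -/
theorem jumpEnergy_le_besovSeminorm [MetricSpace X] [OpensMeasurableSpace X] [SecondCountableTopology X]
    [SFinite μ] {c : ℝ≥0∞} {b : ℝ} (hJ : Measurable J)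
    (hk : ∀ t : ℝ, 0 < t → ∀ x y : X, x ≠ y → t ≤ dist x y ^ b →
      ENNReal.ofReal t * (c * J (x, y)) ≤ k t x y)
    (hf : Measurable f) :
    c * jumpEnergy μ J f ≤ besovSeminorm μ k 1 1 f := by
  set F : X × X → ℝ≥0∞ := fun z => ENNReal.ofReal |f z.1 - f z.2| * J z with hF
  have hm : Measurable F :=
    (continuous_abs.measurable.comp
      ((hf.comp measurable_fst).sub (hf.comp measurable_snd))).ennreal_ofReal.mul hJ
  set T : ℕ → ℝ := fun n => 1 / ((n : ℝ) + 1) with hT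
  have hT0 : ∀ n, 0 < T n := fun n => by simp only [hT]; positivity
  have hTanti : Antitone T := fun m n hmn => by simp only [hT]; gcongr
  set S : ℕ → Set (X × X) := fun n => {z | T n ≤ dist z.1 z.2 ^ b} with hS
  have hSm : ∀ n, MeasurableSet (S n) := fun n =>
    measurableSet_le measurable_const (measurable_dist.pow_const b)
  have hGm : ∀ n, Measurable ((S n).indicator F) := fun n => hm.indicator (hSm n)
  have hmono : Monotone fun n => (S n).indicator F := fun m n hmn =>
    indicator_le_indicator_of_subset (fun z hz => (hTanti hmn).trans hz) (fun _ => zero_le)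
  have hsup : ∀ z, F z = ⨆ n, (S n).indicator F z := by
    intro z
    refine le_antisymm ?_ (iSup_le fun n => indicator_le_self _ _ _)
    rcases eq_or_ne z.1 z.2 with h | h
    · simp [hF, h]
    · have hd : 0 < dist z.1 z.2 ^ b := Real.rpow_pos_of_pos (dist_pos.2 h) b
      obtain ⟨n, hn⟩ := exists_nat_one_div_lt hd
      refine le_iSup_of_le n ?_
      rw [indicator_of_mem (show z ∈ S n from hn.le)]
  have hE : jumpEnergy μ J f = ⨆ n, ∫⁻ z, (S n).indicator F z ∂(μ.prod μ) := by
    rw [← lintegral_iSup hGm hmono]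
    exact lintegral_congr hsup
  rw [hE, ENNReal.mul_iSup, besovSeminorm_one_one]
  refine iSup_le fun n => le_iSup₂_of_le (T n) (hT0 n) ?_
  rw [← lintegral_const_mul _ (hGm n),
    lintegral_prod_symm _ ((hGm n).const_mul c).aemeasurable]
  calc ∫⁻ y, ∫⁻ x, c * (S n).indicator F (x, y) ∂μ ∂μ
      = ENNReal.ofReal (T n)⁻¹ * (ENNReal.ofReal (T n) *
          ∫⁻ y, ∫⁻ x, c * (S n).indicator F (x, y) ∂μ ∂μ) := by
        rw [← mul_assoc, ← ENNReal.ofReal_mul (inv_nonneg.2 (hT0 n).le),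
          inv_mul_cancel₀ (hT0 n).ne', ENNReal.ofReal_one, one_mul]
    _ ≤ _ := by
        gcongr
        rw [← lintegral_const_mul' _ _ ENNReal.ofReal_ne_top]
        refine lintegral_mono fun y => ?_
        rw [← lintegral_const_mul' _ _ ENNReal.ofReal_ne_top]
        refine lintegral_mono fun x => ?_
        by_cases hz : (x, y) ∈ S n
        · rw [indicator_of_mem hz]
          rcases eq_or_ne x y with rfl | hxy
          · simp [hF]
          · calc ENNReal.ofReal (T n) * (c * F (x, y))
                = ENNReal.ofReal |f x - f y| * (ENNReal.ofReal (T n) * (c * J (x, y))) := by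
                  simp only [hF]; ring
              _ ≤ _ := by gcongr; exact hk _ (hT0 n) x y hxy hz
        · simp [indicator_of_notMem hz]

/-- A seminorm comparable to a nonlocal energy satisfies a coarea inequality in both directions. -/
theorem coarea_of_jumpEnergy_comparable [SFinite μ] (hJ : Measurable J) {c C : ℝ≥0}
    (hc : 0 < c) (hC : 0 < C)
    (hlow : ∀ f : X → ℝ, Measurable f → c * jumpEnergy μ J f ≤ besovSeminorm μ k 1 1 f)
    (hup : ∀ f : X → ℝ, Measurable f → besovSeminorm μ k 1 1 f ≤ C * jumpEnergy μ J f) :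
    (∃ C₁ C₂ : ℝ≥0, 0 < C₁ ∧ 0 < C₂ ∧
      ∀ f : X → ℝ, MemLp f 1 μ → (∀ᵐ x ∂μ, 0 ≤ f x) →
        (C₁ : ℝ≥0∞) * (∫⁻ t in Ioi (0 : ℝ), besovSeminorm μ k 1 1 (levelIndicator f t))
          ≤ besovSeminorm μ k 1 1 f ∧
        besovSeminorm μ k 1 1 f
          ≤ (C₂ : ℝ≥0∞) *
            (∫⁻ t in Ioi (0 : ℝ), besovSeminorm μ k 1 1 (levelIndicator f t))) ∧
    (∀ f : X → ℝ, MemBesov μ k 1 1 f →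
      ∀ᵐ t ∂(volume.restrict (Ioi (0 : ℝ))), MemBesov μ k 1 1 (levelIndicator f t)) := by
  have hc' : (c : ℝ≥0∞) ≠ 0 := by exact_mod_cast hc.ne'
  have hC' : (C : ℝ≥0∞) ≠ 0 := by exact_mod_cast hC.ne'
  have hinv : ∀ a : ℝ≥0∞, (c : ℝ≥0∞) * ((c : ℝ≥0∞)⁻¹ * a) = a := fun a => by
    rw [← mul_assoc, ENNReal.mul_inv_cancel hc' ENNReal.coe_ne_top, one_mul]
  -- The energy satisfies coarea with equality, so the only loss is the ratio of the comparison
  -- constants.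
  refine ⟨⟨c * C⁻¹, C * c⁻¹, by positivity, by positivity, fun f hf hf0 => ?_⟩, fun f hf => ?_⟩
  · have hfm := hf.1.aemeasurable
    set g := hfm.mk f with hg
    have hgm : Measurable g := hfm.measurable_mk
    have hfg : f =ᵐ[μ] g := hfm.ae_eq_mk
    have hfg' : f =ᵐ[μ] fun x => max (g x) 0 := by
      filter_upwards [hfg, hf0] with x hx h0
      rw [← hx, max_eq_left h0]
    have hco := lintegral_jumpEnergy_levelIndicator μ hJ hgm
    simp only [fun t => besovSeminorm_congr_ae k 1 1 (levelIndicator_congr_ae hfg t)]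
    rw [besovSeminorm_congr_ae k 1 1 hfg']
    have hgm' : Measurable fun x => max (g x) 0 := hgm.max measurable_const
    have hEm := measurable_jumpEnergy_levelIndicator μ hJ hgm
    constructor
    · calc ((c * C⁻¹ : ℝ≥0) : ℝ≥0∞) *
            ∫⁻ t in Ioi (0 : ℝ), besovSeminorm μ k 1 1 (levelIndicator g t)
          ≤ ((c * C⁻¹ : ℝ≥0) : ℝ≥0∞) *
            ∫⁻ t in Ioi (0 : ℝ), C * jumpEnergy μ J (levelIndicator g t) := by
            gcongr with t
            exact hup _ (measurable_levelIndicator hgm t)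
        _ = c * jumpEnergy μ J fun x => max (g x) 0 := by
            rw [lintegral_const_mul _ hEm, hco, ← mul_assoc, ← ENNReal.coe_mul,
              inv_mul_cancel_right₀ hC.ne']
        _ ≤ _ := hlow _ hgm'
    · calc besovSeminorm μ k 1 1 (fun x => max (g x) 0)
          ≤ C * jumpEnergy μ J fun x => max (g x) 0 := hup _ hgm'
        _ = ((C * c⁻¹ : ℝ≥0) : ℝ≥0∞) *
            ∫⁻ t in Ioi (0 : ℝ), c * jumpEnergy μ J (levelIndicator g t) := by
            rw [lintegral_const_mul _ hEm, hco, ← mul_assoc, ← ENNReal.coe_mul,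
              inv_mul_cancel_right₀ hc.ne']
        _ ≤ _ := by
            gcongr with t
            exact hlow _ (measurable_levelIndicator hgm t)
  · have hf1 : MemLp f 1 μ := by simpa using hf.1
    have hfm := hf1.1.aemeasurable
    set g := hfm.mk f with hg
    have hgm : Measurable g := hfm.measurable_mk
    have hfg : f =ᵐ[μ] g := hfm.ae_eq_mk
    have hEm := measurable_jumpEnergy_levelIndicator μ hJ hgm
    -- The integrated energy of the level sets is finite, so almost every level set has finite
    -- energy, hence finite seminorm.
    have hfin : ∫⁻ t in Ioi (0 : ℝ), jumpEnergy μ J (levelIndicator g t) ≠ ∞ := by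
      rw [lintegral_jumpEnergy_levelIndicator μ hJ hgm]
      refine ((jumpEnergy_posPart_le μ J g).trans_lt ?_).ne
      have h1 := (hlow g hgm).trans_lt
        ((besovSeminorm_congr_ae k 1 1 hfg).symm.trans_lt hf.2)
      exact ENNReal.lt_top_of_mul_ne_top_right h1.ne hc'
    filter_upwards [ae_lt_top hEm hfin, ae_restrict_mem measurableSet_Ioi] with t ht ht0
    refine ⟨by simpa using memLp_levelIndicator hf1 ht0, ?_⟩
    rw [besovSeminorm_congr_ae k 1 1 (levelIndicator_congr_ae hfg t)]
    exact (hup _ (measurable_levelIndicator hgm t)).trans_lt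
      (ENNReal.mul_lt_top ENNReal.coe_lt_top ht)

end Seminorm

end FracBesov

/-! ### Assembly of the kernel bounds and the coarea formula -/

theorem mainTheorem8 {X : Type*} [MetricSpace X] [MeasurableSpace X] [BorelSpace X]
    (μ : Measure X) [μ.Regular] [μ.IsOpenPosMeasure]
    (hball : ∀ (x : X) (r : ℝ), 0 < r → IsCompact (closure (Metric.ball x r)))
    (dH dW : ℝ) (hdH : 0 < dH) (hdW : 2 ≤ dW)
    (hAhlfors : FracBesov.IsAhlforsRegular μ dH)
    (E : FracBesov.DirichletForm μ) (hreg : E.IsRegular) (hloc : E.IsStronglyLocal)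
    (P : ℝ → Lp ℝ 2 μ →L[ℝ] Lp ℝ 2 μ) (hP : E.IsHeatSemigroup P)
    (p : ℝ → X → X → ℝ) (hp : FracBesov.IsContinuousHeatKernel μ P p)
    (hsub : FracBesov.HasSubGaussianBounds μ dH dW p)
    (δ : ℝ) (hδ0 : 0 < δ) (hδ1 : δ < 1)
    (η : ℝ → ℝ → ℝ) (hη : FracBesov.IsStableSubordinator δ η)
    (hcrit : FracBesov.criticalExponent μ (FracBesov.subordinatedKernel η p) 1 = 1) :
    (∃ C₁ C₂ : ℝ≥0, 0 < C₁ ∧ 0 < C₂ ∧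
      ∀ f : X → ℝ, MemLp f 1 μ → (∀ᵐ x ∂μ, 0 ≤ f x) →
        (C₁ : ℝ≥0∞) * (∫⁻ t in Ioi (0 : ℝ),
            FracBesov.besovSeminorm μ (FracBesov.subordinatedKernel η p) 1 1
              (FracBesov.levelIndicator f t))
          ≤ FracBesov.besovSeminorm μ (FracBesov.subordinatedKernel η p) 1 1 f ∧
        FracBesov.besovSeminorm μ (FracBesov.subordinatedKernel η p) 1 1 f
          ≤ (C₂ : ℝ≥0∞) * (∫⁻ t in Ioi (0 : ℝ),
            FracBesov.besovSeminorm μ (FracBesov.subordinatedKernel η p) 1 1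
              (FracBesov.levelIndicator f t))) ∧
    (∀ f : X → ℝ, FracBesov.MemBesov μ (FracBesov.subordinatedKernel η p) 1 1 f →
      ∀ᵐ t ∂(volume.restrict (Ioi (0 : ℝ))),
        FracBesov.MemBesov μ (FracBesov.subordinatedKernel η p) 1 1
          (FracBesov.levelIndicator f t)) ∧
    (∀ f : X → ℝ, MemLp f 1 μ → (∀ᵐ x ∂μ, 0 ≤ f x) →
      (∀ᵐ t ∂(volume.restrict (Ioi (0 : ℝ))),
        FracBesov.MemBesov μ (FracBesov.subordinatedKernel η p) 1 1
          (FracBesov.levelIndicator f t)) →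
      (∫⁻ t in Ioi (0 : ℝ),
        FracBesov.besovSeminorm μ (FracBesov.subordinatedKernel η p) 1 1
          (FracBesov.levelIndicator f t)) < ∞ →
      FracBesov.MemBesov μ (FracBesov.subordinatedKernel η p) 1 1 f) := by
  -- Properness makes `X` second countable and `μ` σ-finite, as the product measure and Tonelli
  -- require.
  have : ProperSpace X := ProperSpace.of_isCompact_closedBall_of_le 0 fun x r _ =>
    (hball x (|r| + 1) (by positivity)).of_isClosed_subset Metric.isClosed_closedBall
      ((Metric.closedBall_subset_ball (by linarith [le_abs_self r])).trans subset_closure)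
  obtain ⟨c₃, c₄, c₅, c₆, h3, h4, h5, h6, hb⟩ := hsub.forall hdW hp.continuous
  obtain ⟨C, hC, hup⟩ := FracBesov.exists_subordinatedKernel_le hdH hdW hδ0 hη h3 h4
    fun t ht x y => (hb t ht x y).2
  obtain ⟨c, hc, hlow⟩ := FracBesov.exists_le_subordinatedKernel hdH hdW hδ0 hδ1 hη h5 h6
    fun t ht x y => (hb t ht x y).1
  -- On the diagonal `J` takes the default value `0 ^ (negative) = 0`; this is harmless, since `|f x
  -- - f y|` vanishes there.
  set J : X × X → ℝ≥0∞ := fun z => ENNReal.ofReal (dist z.1 z.2 ^ (-(dH + δ * dW)))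
  have hJ : Measurable J := (measurable_dist.pow_const _).ennreal_ofReal
  have hfactor : ∀ a t : ℝ, 0 < a → 0 < t → ∀ x y : X,
      ENNReal.ofReal (a * (t * dist x y ^ (-(dH + δ * dW))))
        = ENNReal.ofReal t * ((a.toNNReal : ℝ≥0∞) * J (x, y)) := by
    intro a t ha ht x y
    change _ = ENNReal.ofReal t * (ENNReal.ofReal a * _)
    rw [ENNReal.ofReal_mul ha.le, ENNReal.ofReal_mul ht.le]
    ring
  obtain ⟨⟨C₁, C₂, hC₁, hC₂, hcoarea⟩, hlevel⟩ := FracBesov.coarea_of_jumpEnergy_comparable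
    (μ := μ) (k := FracBesov.subordinatedKernel η p) hJ
    (Real.toNNReal_pos.2 hc) (Real.toNNReal_pos.2 hC)
    (fun f hf => FracBesov.jumpEnergy_le_besovSeminorm hJ
      (fun t ht x y hxy htd => (hfactor c t hc ht x y).symm.trans_le (hlow t ht x y hxy htd)) hf)
    (fun f hf => FracBesov.besovSeminorm_le_jumpEnergy hJ
      (fun t ht x y hxy => (hup t ht x y hxy).trans_eq (hfactor C t hC ht x y)) hf)
  refine ⟨⟨C₁, C₂, hC₁, hC₂, hcoarea⟩, hlevel, fun f hf hf0 _ hfin => ⟨by simpa using hf, ?_⟩⟩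
  exact (hcoarea f hf hf0).2.trans_lt (ENNReal.mul_lt_top ENNReal.coe_lt_top hfin)
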